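/- Let $\alpha>0$. Write $dA$ for area measure on $\mathbb{C}$, $d\lambda_\alpha(w)=\frac{\alpha}{\pi}e^{-\alpha|w|^2}\,dA(w)$ and $K_z(w)=e^{\alpha\bar z w}$. Let $F^\infty_\alpha$ be the space of entire functions $f$ with $\|f\|_{\infty,\alpha}=\operatorname{ess\,sup}_{z\in\mathbb{C}}|f(z)|e^{-\alpha|z|^2/2}<\infty$. Let $BMO$ be the space of locally integrable functions $\varphi:\mathbb{C}\to\mathbb{C}$ for which there is a radius $r>0$ with $$\sup_{z\in\mathbb{C}}\frac{1}{|B(z,r)|}\int_{B(z,r)}|\varphi-\varphi_{B(z,r)}|\,dA<\infty,\qquad \varphi_{B(z,r)}=\frac{1}{|B(z,r)|}\int_{B(z,r)}\varphi\,dA.$$ Let $\varphi\in BMO$. Then for every $f\in F^\infty_\alpha$, every $z\in\mathbb{C}$ and every $t>0$ the integrals $$T_\varphi f(z)=\int_{\mathbb{C}}\varphi(w)f(w)\overline{K_z(w)}\,d\lambda_\alpha(w),\qquad \tilde\varphi_t(z)=\frac{\alpha}{\pi}\int_{\mathbb{C}}\varphi(w)e^{-\frac{\alpha t}{2}|z-w|^2}\,dA(w)$$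 converge absolutely, and for every $t>0$ the following are equivalent: 1. the Toeplitz operator $T_\varphi$ is bounded on $F^\infty_\alpha$, that is, it maps $F^\infty_\alpha$ into itself and there is a constant $C$ with $\|T_\varphi f\|_{\infty,\alpha}\le C\|f\|_{\infty,\alpha}$ for all $f\in F^\infty_\alpha$; 2. $\tilde\varphi_t\in L^\infty(\mathbb{C},dA)$. -/

import Mathlib

open MeasureTheory ComplexConjugate

noncomputable section

namespace FockToeplitz

/-- The Gaussian measure `dλ_α(z) = (α/π) e^{-α|z|²} dA(z)` on `ℂ`. -/
def gaussian (α : ℝ) : Measure ℂ :=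
  volume.withDensity fun z => ENNReal.ofReal (α / Real.pi * Real.exp (-α * ‖z‖ ^ 2))

/-- The weighted function `z ↦ f(z) e^{-α|z|²/2}`. -/
def weighted (α : ℝ) (f : ℂ → ℂ) (z : ℂ) : ℂ :=
  f z * (Real.exp (-α * ‖z‖ ^ 2 / 2) : ℂ)

/-- `f ∈ F^∞_α`: `f` is entire and `f(z) e^{-α|z|²/2}` is in `L^∞(ℂ, dA)`. -/
def MemFockInfty (α : ℝ) (f : ℂ → ℂ) : Prop :=
  Differentiable ℂ f ∧ MemLp (weighted α f) ⊤ volume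

/-- The norm `‖f‖_{∞,α} = ess sup |f(z)| e^{-α|z|²/2}`, as an extended nonnegative real. -/
def fockNorm (α : ℝ) (f : ℂ → ℂ) : ENNReal :=
  eLpNorm (weighted α f) ⊤ volume

/-- The reproducing kernel `K_z(w) = e^{α z̄ w}`. -/
def kernel (α : ℝ) (z w : ℂ) : ℂ :=
  Complex.exp (α * conj z * w)

/-- The Toeplitz operator `T_φ f(z) = ∫ φ(w) f(w) conj(K_z(w)) dλ_α(w)`. -/
def toeplitz (α : ℝ) (φ f : ℂ → ℂ) (z : ℂ) : ℂ :=
  ∫ w, φ w * f w * conj (kernel α z w) ∂(gaussian α)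

/-- `T_φ` maps `F^∞_α` into itself and is bounded for the norm of `F^∞_α`. -/
def ToeplitzBounded (α : ℝ) (φ : ℂ → ℂ) : Prop :=
  ∃ C : NNReal, ∀ f : ℂ → ℂ, MemFockInfty α f →
    MemFockInfty α (toeplitz α φ f) ∧ fockNorm α (toeplitz α φ f) ≤ C * fockNorm α f

/-- The `t`-Berezin transform `φ̃_t(z) = (α/π) ∫ φ(w) e^{-αt|z-w|²/2} dA(w)`. -/
def berezin (α t : ℝ) (φ : ℂ → ℂ) (z : ℂ) : ℂ :=
  (α / Real.pi : ℂ) * ∫ w, φ w * (Real.exp (-α * t * ‖z - w‖ ^ 2 / 2) : ℂ)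

/-- `φ ∈ BMO`, the space used for Fock spaces: `φ` is locally integrable and its mean
oscillation over the discs of some fixed radius `r > 0` is bounded uniformly in the centre.
(The space does not depend on the radius, and it contains the classical `BMO(ℝ²)`.) -/
def MemBMO (φ : ℂ → ℂ) : Prop :=
  LocallyIntegrable φ volume ∧
    ∃ r : ℝ, 0 < r ∧ ∃ C : ℝ, ∀ z : ℂ,
      (⨍ w in Metric.ball z r, ‖φ w - ⨍ u in Metric.ball z r, φ u‖) ≤ C

end FockToeplitz

end

/-! For a `BMO` symbol, all Gaussian averages, of any variance and with or without a modulus inside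
the integral, are bounded together. The disc means `c z` change by a bounded amount over distance
`r`, so they grow at most linearly, and Gaussian decay turns the bound on disc oscillations into a
bound on `∫ |φ - c z| e^{-b|z-w|²}` uniform in `z`, for every `b > 0`. Thus each Gaussian average of
`φ` is a multiple of `c z` up to `O(1)`, while the average of `|φ|` is at most a multiple of `|c z|`
plus `O(1)`. This is `MemBMO.exists_integral_norm_mul_exp_le`.

The operator needs two explicit averages. Completing the square bounds `|T_φ f(z)| e^{-α|z|²/2}` by
`‖f‖` times an average of `|φ|` with exponent `α/2` (`MemBMO.norm_weighted_toeplitz_le`).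
Conversely, evaluating `T_φ K_z` at `z` gives the average of `φ` with exponent `α`
(`weighted_toeplitz_kernel`). The comparison passes between these and the exponent `αt/2` of the
Berezin transform. -/

namespace FockToeplitz

/-! ### Disc means of a BMO function -/

/-- The oscillation of a `BMO` function about suitable constants (its means), in extended form. -/
theorem MemBMO.exists_lintegral_le {φ : ℂ → ℂ} (hφ : MemBMO φ) :
    ∃ r : ℝ, 0 < r ∧ ∃ (c : ℂ → ℂ) (M : ENNReal), M ≠ ⊤ ∧
      ∀ z, ∫⁻ w in Metric.ball z r, ‖φ w - c z‖ₑ ≤ M := by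
  obtain ⟨hloc, r, hr, C, hC⟩ := hφ
  refine ⟨r, hr, fun z => ⨍ u in Metric.ball z r, φ u,
    volume (Metric.ball (0 : ℂ) r) * ENNReal.ofReal C,
    ENNReal.mul_ne_top measure_ball_lt_top.ne ENNReal.ofReal_ne_top, fun z => ?_⟩
  have hint : IntegrableOn (fun w => φ w - ⨍ u in Metric.ball z r, φ u) (Metric.ball z r) :=
    ((hloc.integrableOn_isCompact (isCompact_closedBall z r)).mono_set
      Metric.ball_subset_closedBall).sub
      (integrableOn_const (measure_ball_lt_top.ne))
  have h := hC z
  have hpos : 0 < volume.real (Metric.ball z r) :=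
    ENNReal.toReal_pos (Metric.measure_ball_pos _ _ hr).ne' measure_ball_lt_top.ne
  rw [setAverage_eq, smul_eq_mul, inv_mul_le_iff₀ hpos] at h
  rw [← ofReal_integral_norm_eq_lintegral_enorm hint, ← Measure.addHaar_ball_center volume z r]
  refine (ENNReal.ofReal_le_ofReal h).trans ?_
  rw [ENNReal.ofReal_mul hpos.le, Measure.real, ENNReal.ofReal_toReal measure_ball_lt_top.ne]

variable {φ f c : ℂ → ℂ} {r : ℝ} {M : ENNReal}

/-- The disc of radius `r / 2` about the midpoint of `z` and `w` lies in both discs of radius `r`,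
so on it `φ` is close in mean to both `c z` and `c w`. -/
theorem exists_norm_sub_le_of_norm_sub_le (hφ : AEStronglyMeasurable φ) (hr : 0 < r) (hM : M ≠ ⊤)
    (h : ∀ z, ∫⁻ w in Metric.ball z r, ‖φ w - c z‖ₑ ≤ M) :
    ∃ D : ℝ, ∀ z w, ‖z - w‖ ≤ r → ‖c z - c w‖ ≤ D := by
  have hr2 : 0 < r / 2 := half_pos hr
  refine ⟨((M + M) / volume (Metric.ball (0 : ℂ) (r / 2))).toReal, fun z w hzw => ?_⟩
  have hpos := (Metric.measure_ball_pos volume (0 : ℂ) hr2).ne'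
  set m := (z + w) / 2
  have hsub : ∀ p, ‖m - p‖ ≤ r / 2 →
      ∫⁻ u in Metric.ball m (r / 2), ‖φ u - c p‖ₑ ≤ M := fun p hp =>
    (lintegral_mono_set (Metric.ball_subset_ball' (by rw [dist_eq_norm]; linarith))).trans (h p)
  have hz : ‖m - z‖ ≤ r / 2 := by
    have : m - z = -((z - w) / 2) := by simp only [m]; ring
    rw [this, norm_neg, norm_div]; norm_num; linarith
  have hw : ‖m - w‖ ≤ r / 2 := by
    have : m - w = (z - w) / 2 := by simp only [m]; ring
    rw [this, norm_div]; norm_num; linarith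
  have key : ‖c z - c w‖ₑ * volume (Metric.ball (0 : ℂ) (r / 2)) ≤ M + M := by
    rw [← Measure.addHaar_ball_center volume m, ← setLIntegral_const]
    calc ∫⁻ _ in Metric.ball m (r / 2), ‖c z - c w‖ₑ
        ≤ ∫⁻ u in Metric.ball m (r / 2), (‖φ u - c z‖ₑ + ‖φ u - c w‖ₑ) := by
          refine lintegral_mono fun u => ?_
          have : c z - c w = (φ u - c w) - (φ u - c z) := by ring
          rw [this, add_comm]
          exact enorm_sub_le
      _ = _ := lintegral_add_left'
          ((hφ.sub aestronglyMeasurable_const).enorm.mono_measure Measure.restrict_le_self) _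
      _ ≤ M + M := add_le_add (hsub z hz) (hsub w hw)
  rw [← toReal_enorm]
  refine ENNReal.toReal_mono (ENNReal.div_ne_top (by simp [hM]) hpos) ?_
  rwa [ENNReal.le_div_iff_mul_le (Or.inl hpos) (Or.inl measure_ball_lt_top.ne)]

/-- A map with bounded increments at scale `r` grows at most linearly. -/
theorem norm_sub_le_linear {D : ℝ} (hr : 0 < r)
    (h : ∀ z w, ‖z - w‖ ≤ r → ‖c z - c w‖ ≤ D) (z w : ℂ) :
    ‖c z - c w‖ ≤ D * (1 + ‖z - w‖ / r) := by
  have hD : 0 ≤ D := (norm_nonneg _).trans (h 0 0 (by simpa using hr.le))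
  have chain : ∀ n : ℕ, ∀ z w, ‖z - w‖ ≤ n * r → ‖c z - c w‖ ≤ n * D := by
    intro n
    induction n with
    | zero =>
      intro z w hzw
      have : z = w := by simpa [sub_eq_zero] using hzw
      simp [this]
    | succ n ih =>
      intro z w hzw
      push_cast at hzw ⊢
      have hn : (0 : ℝ) < n + 1 := by positivity
      have hnC : (n + 1 : ℂ) ≠ 0 := by exact_mod_cast hn.ne'
      have hnn : ‖(n + 1 : ℂ)‖ = n + 1 := by
        rw [← Nat.cast_add_one, Complex.norm_natCast]; push_cast; rfl
      -- One of `n + 1` equal steps along the segment from `z` to `w`.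
      set p : ℂ := z - (z - w) / (n + 1)
      have h1 : ‖z - p‖ ≤ r := by
        have : z - p = (z - w) / (n + 1) := by simp only [p]; ring
        rw [this, norm_div, hnn, div_le_iff₀ hn]; linarith
      have h2 : ‖p - w‖ ≤ n * r := by
        have : p - w = (z - w) / (n + 1) * n := by simp only [p]; field_simp; ring
        rw [this, norm_mul, norm_div, hnn, Complex.norm_natCast, mul_comm]
        gcongr
        rw [div_le_iff₀ hn]; linarith
      calc ‖c z - c w‖ ≤ ‖c z - c p‖ + ‖c p - c w‖ := norm_sub_le_norm_sub_add_norm_sub _ _ _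
        _ ≤ D + n * D := add_le_add (h _ _ h1) (ih _ _ h2)
        _ = _ := by ring
  refine (chain ⌈‖z - w‖ / r⌉₊ z w ?_).trans ?_
  · rw [← div_le_iff₀ hr]; exact Nat.le_ceil _
  · rw [mul_comm]
    gcongr
    linarith [Nat.ceil_lt_add_one (a := ‖z - w‖ / r) (by positivity)]

/-! ### Gaussian mean oscillation -/

/-- Integrating the integrals over all discs of radius `r` multiplies the integral by the area. -/
theorem lintegral_lintegral_ball {g : ℂ → ENNReal} (hg : AEMeasurable g) (r : ℝ) :
    ∫⁻ u, ∫⁻ w in Metric.ball u r, g w = volume (Metric.ball (0 : ℂ) r) * ∫⁻ w, g w := by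
  have hS : MeasurableSet {p : ℂ × ℂ | dist p.2 p.1 < r} :=
    measurableSet_lt (by fun_prop) measurable_const
  calc ∫⁻ u, ∫⁻ w in Metric.ball u r, g w
      = ∫⁻ u, ∫⁻ w, {p : ℂ × ℂ | dist p.2 p.1 < r}.indicator (fun p => g p.2) (u, w) := by
        refine lintegral_congr fun u => ?_
        rw [← lintegral_indicator Metric.isOpen_ball.measurableSet]
        rfl
    _ = ∫⁻ w, ∫⁻ u, {p : ℂ × ℂ | dist p.2 p.1 < r}.indicator (fun p => g p.2) (u, w) :=
        lintegral_lintegral_swap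
          ((hg.comp_quasiMeasurePreserving Measure.quasiMeasurePreserving_snd).indicator hS)
    _ = ∫⁻ w, volume (Metric.ball (0 : ℂ) r) * g w := by
        refine lintegral_congr fun w => ?_
        rw [← Measure.addHaar_ball_center volume w, mul_comm, ← setLIntegral_const,
          ← lintegral_indicator Metric.isOpen_ball.measurableSet]
        refine lintegral_congr fun u => ?_
        simp only [Set.indicator, Set.mem_ofPred_eq, Metric.mem_ball, dist_comm]
    _ = _ := lintegral_const_mul'' _ hg

theorem integrable_exp_neg_mul_sq_norm {b : ℝ} (hb : 0 < b) :
    Integrable (fun v : ℂ => Real.exp (-b * ‖v‖ ^ 2)) := by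
  have := (GaussianFourier.integrable_cexp_neg_mul_sq_norm_add (b := (b : ℂ)) (V := ℂ)
    (by simpa using hb) 0 0).norm
  refine this.congr (Filter.Eventually.of_forall fun v => ?_)
  simp only [Complex.norm_exp]
  norm_cast
  simp

/-- Half of the Gaussian absorbs the linear factor, since `‖v‖ e^{-b‖v‖²/2}` is bounded; the other
half is integrable. -/
theorem lintegral_linear_mul_exp_lt_top {b : ℝ} (hb : 0 < b) (A D : ℝ) :
    ∫⁻ v : ℂ, ENNReal.ofReal ((A + D * ‖v‖) * Real.exp (-b * ‖v‖ ^ 2)) < ⊤ := by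
  have hi := ((integrable_exp_neg_mul_sq_norm (half_pos hb)).const_mul
    (|A| + |D| * (1 / b + 1))).lintegral_lt_top
  refine lt_of_le_of_lt (lintegral_mono fun v => ENNReal.ofReal_le_ofReal ?_) hi
  have hsplit : Real.exp (-b * ‖v‖ ^ 2) =
      Real.exp (-(b / 2) * ‖v‖ ^ 2) * Real.exp (-(b / 2) * ‖v‖ ^ 2) := by
    rw [← Real.exp_add]; ring_nf
  set E := Real.exp (-(b / 2) * ‖v‖ ^ 2) with hE
  have hE0 : 0 < E := Real.exp_pos _
  have hE1 : E ≤ 1 := Real.exp_le_one_iff.2 (by nlinarith [sq_nonneg ‖v‖])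
  have hEv : ‖v‖ * E ≤ 1 / b + 1 := by
    have h1 : b / 2 * ‖v‖ ^ 2 + 1 ≤ Real.exp (b / 2 * ‖v‖ ^ 2) := Real.add_one_le_exp _
    have h2 : E * Real.exp (b / 2 * ‖v‖ ^ 2) = 1 := by
      rw [hE, ← Real.exp_add]; simp
    have h3 : ‖v‖ ≤ (1 / b + 1) * (b / 2 * ‖v‖ ^ 2 + 1) := by
      have : (1 / b + 1) * (b / 2 * ‖v‖ ^ 2 + 1) = ‖v‖ ^ 2 / 2 + b / 2 * ‖v‖ ^ 2 + 1 / b + 1 := by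
        field_simp
        ring
      rw [this]
      have : 0 ≤ b / 2 * ‖v‖ ^ 2 := by positivity
      have : 0 < 1 / b := by positivity
      nlinarith [sq_nonneg (‖v‖ - 1)]
    calc ‖v‖ * E ≤ (1 / b + 1) * Real.exp (b / 2 * ‖v‖ ^ 2) * E := by
          gcongr
          exact h3.trans (by gcongr)
      _ = (1 / b + 1) * (E * Real.exp (b / 2 * ‖v‖ ^ 2)) := by ring
      _ = _ := by rw [h2, mul_one]
  rw [hsplit, ← mul_assoc]
  gcongr
  have hA : A * E ≤ |A| := by
    calc A * E ≤ |A| * E := by gcongr; exact le_abs_self A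
      _ ≤ |A| * 1 := by gcongr
      _ = |A| := mul_one _
  have hD : D * (‖v‖ * E) ≤ |D| * (1 / b + 1) := by
    calc D * (‖v‖ * E) ≤ |D| * (‖v‖ * E) := by gcongr; exact le_abs_self D
      _ ≤ _ := by gcongr
  linarith

/-- The Gaussian mean oscillation of a function of bounded mean oscillation is bounded. -/
theorem exists_lintegral_mul_exp_le (hφ : AEStronglyMeasurable φ) (hr : 0 < r) (hM : M ≠ ⊤)
    (h : ∀ z, ∫⁻ w in Metric.ball z r, ‖φ w - c z‖ₑ ≤ M) {b : ℝ} (hb : 0 < b) :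
    ∃ K : ENNReal, K ≠ ⊤ ∧
      ∀ z, ∫⁻ w, ‖φ w - c z‖ₑ * ENNReal.ofReal (Real.exp (-b * ‖z - w‖ ^ 2)) ≤ K := by
  obtain ⟨D, hD⟩ := exists_norm_sub_le_of_norm_sub_le hφ hr hM h
  have hD0 : 0 ≤ D := (norm_nonneg _).trans (hD 0 0 (by simpa using hr.le))
  have hlin := norm_sub_le_linear hr hD
  set V := volume (Metric.ball (0 : ℂ) r)
  have hV : V ≠ ⊤ := measure_ball_lt_top.ne
  have hV0 : V ≠ 0 := (Metric.measure_ball_pos volume (0 : ℂ) hr).ne'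
  set m := M.toReal
  set v := V.toReal
  set J := ∫⁻ x : ℂ, ENNReal.ofReal
    (((m + v * D) + v * D / r * ‖x‖) * Real.exp (-(b / 2) * ‖x‖ ^ 2))
  have hJ : J < ⊤ := lintegral_linear_mul_exp_lt_top (half_pos hb) _ _
  refine ⟨ENNReal.ofReal (Real.exp (b * r ^ 2)) * J / V,
    ENNReal.div_ne_top (ENNReal.mul_ne_top ENNReal.ofReal_ne_top hJ.ne) hV0, fun z => ?_⟩
  have hmeas : AEMeasurable
      (fun w => ‖φ w - c z‖ₑ * ENNReal.ofReal (Real.exp (-b * ‖z - w‖ ^ 2))) :=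
    (hφ.sub aestronglyMeasurable_const).enorm.mul (by fun_prop)
  -- Multiplying by the disc area `V` turns the integral into an integral over centres `u` of disc
  -- integrals. On each disc `φ` is compared with `c u`, and `c u` with `c z` by linear growth.
  rw [ENNReal.le_div_iff_mul_le (Or.inl hV0) (Or.inl hV), mul_comm,
    ← lintegral_lintegral_ball hmeas r,
    show J = _ from (lintegral_sub_left_eq_self (μ := volume) _ z).symm,
    ← lintegral_const_mul' _ _ ENNReal.ofReal_ne_top]
  refine lintegral_mono fun u => ?_
  set e := ENNReal.ofReal (Real.exp (b * r ^ 2) * Real.exp (-(b / 2) * ‖z - u‖ ^ 2))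
  have hexp : ∀ w ∈ Metric.ball u r,
      ‖φ w - c z‖ₑ * ENNReal.ofReal (Real.exp (-b * ‖z - w‖ ^ 2)) ≤
        (‖φ w - c u‖ₑ + ‖c u - c z‖ₑ) * e := by
    intro w hw
    have hw' : ‖w - u‖ < r := by rwa [← dist_eq_norm]
    gcongr
    · calc ‖φ w - c z‖ₑ = ‖(φ w - c u) + (c u - c z)‖ₑ := by ring_nf
        _ ≤ _ := enorm_add_le _ _
    · refine ENNReal.ofReal_le_ofReal ?_
      rw [← Real.exp_add]
      refine Real.exp_le_exp.2 ?_
      have htri : ‖z - u‖ ≤ ‖z - w‖ + ‖w - u‖ := norm_sub_le_norm_sub_add_norm_sub _ _ _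
      -- Moving the Gaussian from `w` to the centre `u` halves the exponent `b` and costs the factor
      -- `e^{br²}`.
      have hsq : ‖z - u‖ ^ 2 ≤ 2 * ‖z - w‖ ^ 2 + 2 * r ^ 2 := by
        have h1 : ‖z - u‖ ≤ ‖z - w‖ + r := by linarith
        have h2 : ‖z - u‖ ^ 2 ≤ (‖z - w‖ + r) ^ 2 := by gcongr
        nlinarith [sq_nonneg (‖z - w‖ - r)]
      nlinarith
  calc ∫⁻ w in Metric.ball u r, ‖φ w - c z‖ₑ * ENNReal.ofReal (Real.exp (-b * ‖z - w‖ ^ 2))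
      ≤ ∫⁻ w in Metric.ball u r, (‖φ w - c u‖ₑ + ‖c u - c z‖ₑ) * e :=
        setLIntegral_mono' Metric.isOpen_ball.measurableSet hexp
    _ = (∫⁻ w in Metric.ball u r, (‖φ w - c u‖ₑ + ‖c u - c z‖ₑ)) * e :=
        lintegral_mul_const' _ _ ENNReal.ofReal_ne_top
    _ = ((∫⁻ w in Metric.ball u r, ‖φ w - c u‖ₑ) + ‖c u - c z‖ₑ * V) * e := by
        rw [lintegral_add_right _ measurable_const, setLIntegral_const,
          Measure.addHaar_ball_center]
    _ ≤ (ENNReal.ofReal m + ENNReal.ofReal (D * (1 + ‖z - u‖ / r)) * ENNReal.ofReal v) * e := by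
        gcongr
        · rw [ENNReal.ofReal_toReal hM]; exact h u
        · rw [← ofReal_norm, norm_sub_rev]
          exact ENNReal.ofReal_le_ofReal (hlin z u)
        · rw [ENNReal.ofReal_toReal hV]
    _ = _ := by
        have hm : 0 ≤ m := ENNReal.toReal_nonneg
        have hv : 0 ≤ v := ENNReal.toReal_nonneg
        rw [← ENNReal.ofReal_mul (by positivity), ← ENNReal.ofReal_add (by positivity)
          (by positivity), ← ENNReal.ofReal_mul (by positivity),
          ← ENNReal.ofReal_mul (by positivity)]
        congr 1
        ring

/-! ### Comparison of Gaussian averages -/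

theorem MemBMO.aestronglyMeasurable (hφ : MemBMO φ) : AEStronglyMeasurable φ :=
  hφ.1.aestronglyMeasurable

theorem MemBMO.exists_integral_norm_sub_mul_exp_le (hφ : MemBMO φ) :
    ∃ c : ℂ → ℂ, ∀ b : ℝ, 0 < b → ∃ K : ℝ, ∀ z,
      Integrable (fun w => (φ w - c z) * (Real.exp (-b * ‖z - w‖ ^ 2) : ℂ)) ∧
      ∫ w, ‖φ w - c z‖ * Real.exp (-b * ‖z - w‖ ^ 2) ≤ K := by
  obtain ⟨r, hr, c, M, hM, h⟩ := hφ.exists_lintegral_le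
  refine ⟨c, fun b hb => ?_⟩
  obtain ⟨K, hK, hle⟩ := exists_lintegral_mul_exp_le hφ.aestronglyMeasurable hr hM h hb
  refine ⟨K.toReal, fun z => ?_⟩
  have hnorm : ∀ w, ‖(φ w - c z) * (Real.exp (-b * ‖z - w‖ ^ 2) : ℂ)‖ =
      ‖φ w - c z‖ * Real.exp (-b * ‖z - w‖ ^ 2) := fun w => by
    rw [norm_mul, Complex.norm_real, Real.norm_of_nonneg (Real.exp_pos _).le]
  have henorm : ∫⁻ w, ‖(φ w - c z) * (Real.exp (-b * ‖z - w‖ ^ 2) : ℂ)‖ₑ ≤ K := by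
    refine le_trans (le_of_eq (lintegral_congr fun w => ?_)) (hle z)
    rw [← ofReal_norm, hnorm, ENNReal.ofReal_mul (norm_nonneg _), ofReal_norm]
  have hint : Integrable (fun w => (φ w - c z) * (Real.exp (-b * ‖z - w‖ ^ 2) : ℂ)) :=
    ⟨(hφ.aestronglyMeasurable.sub aestronglyMeasurable_const).mul
      (Continuous.aestronglyMeasurable (by fun_prop)), henorm.trans_lt hK.lt_top⟩
  refine ⟨hint, ?_⟩
  simp_rw [← hnorm]
  rw [integral_norm_eq_lintegral_enorm hint.1]
  exact ENNReal.toReal_mono hK henorm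

theorem integrable_exp_neg_mul_sq_norm_sub {b : ℝ} (hb : 0 < b) (z : ℂ) :
    Integrable (fun w : ℂ => Real.exp (-b * ‖z - w‖ ^ 2)) :=
  (integrable_exp_neg_mul_sq_norm hb).comp_sub_left z

theorem MemBMO.integrable_mul_exp (hφ : MemBMO φ) {b : ℝ} (hb : 0 < b) (z : ℂ) :
    Integrable (fun w => φ w * (Real.exp (-b * ‖z - w‖ ^ 2) : ℂ)) := by
  obtain ⟨c, hc⟩ := hφ.exists_integral_norm_sub_mul_exp_le
  obtain ⟨K, hK⟩ := hc b hb
  refine ((hK z).1.add (((integrable_exp_neg_mul_sq_norm_sub hb z).ofReal (𝕜 := ℂ)).const_mul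
    (c z))).congr (Filter.Eventually.of_forall fun w => ?_)
  simp only [Pi.add_apply, Complex.coe_algebraMap]
  ring

theorem MemBMO.integrable_norm_mul_exp (hφ : MemBMO φ) {b : ℝ} (hb : 0 < b) (z : ℂ) :
    Integrable (fun w => ‖φ w‖ * Real.exp (-b * ‖z - w‖ ^ 2)) := by
  refine (hφ.integrable_mul_exp hb z).norm.congr (Filter.Eventually.of_forall fun w => ?_)
  simp only [norm_mul, Complex.norm_real, Real.norm_of_nonneg (Real.exp_pos _).le]

/-- For a function of bounded mean oscillation, the Gaussian averages of its modulus are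
controlled by the modulus of its Gaussian averages, whatever the two variances. -/
theorem MemBMO.exists_integral_norm_mul_exp_le (hφ : MemBMO φ) {a b : ℝ} (ha : 0 < a)
    (hb : 0 < b) :
    ∃ A B : ℝ, 0 ≤ B ∧ ∀ z, ∫ w, ‖φ w‖ * Real.exp (-a * ‖z - w‖ ^ 2) ≤
      A + B * ‖∫ w, φ w * (Real.exp (-b * ‖z - w‖ ^ 2) : ℂ)‖ := by
  obtain ⟨c, hc⟩ := hφ.exists_integral_norm_sub_mul_exp_le
  obtain ⟨K, hK⟩ := hc a ha
  obtain ⟨L, hL⟩ := hc b hb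
  set G : ℝ → ℝ := fun s => ∫ w : ℂ, Real.exp (-s * ‖w‖ ^ 2)
  have hG : ∀ s z, ∫ w : ℂ, Real.exp (-s * ‖z - w‖ ^ 2) = G s := fun s z =>
    integral_sub_left_eq_self (fun w : ℂ => Real.exp (-s * ‖w‖ ^ 2)) volume z
  have hGb : 0 < G b := by
    simp only [G, GaussianFourier.integral_rexp_neg_mul_sq_norm hb]
    have := Real.pi_pos
    positivity
  have hGa : 0 ≤ G a := integral_nonneg fun _ => (Real.exp_pos _).le
  refine ⟨K + G a / G b * L, G a / G b, by positivity, fun z => ?_⟩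
  set I := ∫ w, φ w * (Real.exp (-b * ‖z - w‖ ^ 2) : ℂ)
  have hnorm : ∀ s w, ‖(φ w - c z) * (Real.exp (-s * ‖z - w‖ ^ 2) : ℂ)‖ =
      ‖φ w - c z‖ * Real.exp (-s * ‖z - w‖ ^ 2) := fun s w => by
    rw [norm_mul, Complex.norm_real, Real.norm_of_nonneg (Real.exp_pos _).le]
  -- The `b`-average controls `c z`, which in turn controls the `a`-average of `|φ|`; the same `c`
  -- serves both exponents.
  have hcz : ‖c z‖ * G b ≤ ‖I‖ + L := by
    have hsplit : c z * (G b : ℂ) =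
        I - ∫ w, (φ w - c z) * (Real.exp (-b * ‖z - w‖ ^ 2) : ℂ) := by
      rw [← integral_sub (hφ.integrable_mul_exp hb z) (hL z).1, ← hG b z,
        ← integral_complex_ofReal, ← integral_const_mul]
      congr 1 with w
      ring
    calc ‖c z‖ * G b = ‖c z * (G b : ℂ)‖ := by
          rw [norm_mul, Complex.norm_real, Real.norm_of_nonneg hGb.le]
      _ ≤ ‖I‖ + ‖∫ w, (φ w - c z) * (Real.exp (-b * ‖z - w‖ ^ 2) : ℂ)‖ := by
          rw [hsplit]; exact norm_sub_le _ _
      _ ≤ ‖I‖ + L := by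
          gcongr
          refine (norm_integral_le_integral_norm _).trans ?_
          simp_rw [hnorm]
          exact (hL z).2
  have hint : Integrable (fun w => ‖φ w - c z‖ * Real.exp (-a * ‖z - w‖ ^ 2)) := by
    simp_rw [← hnorm]; exact (hK z).1.norm
  calc ∫ w, ‖φ w‖ * Real.exp (-a * ‖z - w‖ ^ 2)
      ≤ ∫ w, (‖φ w - c z‖ * Real.exp (-a * ‖z - w‖ ^ 2) +
          ‖c z‖ * Real.exp (-a * ‖z - w‖ ^ 2)) := by
        refine integral_mono (hφ.integrable_norm_mul_exp ha z)
          (hint.add ((integrable_exp_neg_mul_sq_norm_sub ha z).const_mul _)) fun w => ?_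
        simp only [← add_mul]
        gcongr
        exact norm_le_norm_sub_add _ _
    _ = (∫ w, ‖φ w - c z‖ * Real.exp (-a * ‖z - w‖ ^ 2)) + ‖c z‖ * G a := by
        rw [integral_add hint ((integrable_exp_neg_mul_sq_norm_sub ha z).const_mul _),
          integral_const_mul, hG]
    _ ≤ K + G a / G b * (‖c z‖ * G b) := by
        have : G a / G b * (‖c z‖ * G b) = ‖c z‖ * G a := by field_simp
        rw [this]
        gcongr
        exact (hK z).2
    _ ≤ K + G a / G b * (‖I‖ + L) := by gcongr
    _ = _ := by ring

/-! ### The Toeplitz integral: convergence, growth, holomorphy -/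

variable {α : ℝ}

theorem measurable_gaussian_density (α : ℝ) :
    Measurable fun z : ℂ => ENNReal.ofReal (α / Real.pi * Real.exp (-α * ‖z‖ ^ 2)) := by
  fun_prop

theorem integrable_gaussian_iff (hα : 0 < α) {g : ℂ → ℂ} :
    Integrable g (gaussian α) ↔
      Integrable fun w => ((α / Real.pi * Real.exp (-α * ‖w‖ ^ 2) : ℝ) : ℂ) * g w := by
  have hpi := Real.pi_pos
  rw [gaussian, integrable_withDensity_iff_integrable_smul' (measurable_gaussian_density α)
    (Filter.Eventually.of_forall fun _ => ENNReal.ofReal_lt_top)]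
  refine integrable_congr (Filter.Eventually.of_forall fun w => ?_)
  simp only [Complex.real_smul]
  rw [ENNReal.toReal_ofReal (by positivity)]

theorem integral_gaussian (hα : 0 < α) (g : ℂ → ℂ) :
    ∫ w, g w ∂(gaussian α) =
      ∫ w, ((α / Real.pi * Real.exp (-α * ‖w‖ ^ 2) : ℝ) : ℂ) * g w := by
  have hpi := Real.pi_pos
  rw [gaussian, integral_withDensity_eq_integral_toReal_smul (measurable_gaussian_density α)
    (Filter.Eventually.of_forall fun _ => ENNReal.ofReal_lt_top)]
  congr 1 with w
  rw [Complex.real_smul, ENNReal.toReal_ofReal (by positivity)]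

theorem conj_kernel (α : ℝ) (z w : ℂ) : conj (kernel α z w) = Complex.exp (α * z * conj w) := by
  simp [kernel, ← Complex.exp_conj]

theorem norm_sub_sq_eq (z w : ℂ) :
    ‖z - w‖ ^ 2 = ‖z‖ ^ 2 + ‖w‖ ^ 2 - 2 * (z * conj w).re := by
  simp only [Complex.sq_norm, Complex.normSq_sub]

theorem norm_weighted (α : ℝ) (f : ℂ → ℂ) (z : ℂ) :
    ‖weighted α f z‖ = ‖f z‖ * Real.exp (-α * ‖z‖ ^ 2 / 2) := by
  rw [weighted, norm_mul, Complex.norm_real, Real.norm_of_nonneg (Real.exp_pos _).le]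

/-- The modulus of the integrand of the Toeplitz operator with respect to area measure. -/
theorem norm_toeplitz_integrand (hα : 0 < α) (φ f : ℂ → ℂ) (z w : ℂ) :
    ‖((α / Real.pi * Real.exp (-α * ‖w‖ ^ 2) : ℝ) : ℂ) *
        (φ w * f w * Complex.exp (α * z * conj w))‖ =
      Real.exp (α * ‖z‖ ^ 2 / 2) * (α / Real.pi) *
        (‖weighted α f w‖ * (‖φ w‖ * Real.exp (-(α / 2) * ‖z - w‖ ^ 2))) := by
  have hpi := Real.pi_pos
  rw [norm_mul, norm_mul, norm_mul, Complex.norm_real, Real.norm_of_nonneg (by positivity),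
    Complex.norm_exp, norm_weighted, norm_sub_sq_eq]
  have hre : ((α : ℂ) * z * conj w).re = α * (z * conj w).re := by
    rw [mul_assoc, Complex.re_ofReal_mul]
  have hexp : Real.exp (-α * ‖w‖ ^ 2) * Real.exp (α * (z * conj w).re) =
      Real.exp (α * ‖z‖ ^ 2 / 2) * Real.exp (-α * ‖w‖ ^ 2 / 2) *
        Real.exp (-(α / 2) * (‖z‖ ^ 2 + ‖w‖ ^ 2 - 2 * (z * conj w).re)) := by
    simp only [← Real.exp_add]
    ring_nf
  rw [hre]
  linear_combination (α / Real.pi * ‖φ w‖ * ‖f w‖) * hexp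

theorem MemFockInfty.ae_norm_weighted_le (hf : MemFockInfty α f) :
    ∀ᵐ w, ‖weighted α f w‖ ≤ (fockNorm α f).toReal := by
  have htop : fockNorm α f ≠ ⊤ := hf.2.2.ne
  filter_upwards [ae_le_eLpNormEssSup (f := weighted α f) (μ := volume)] with w hw
  rw [← eLpNorm_exponent_top] at hw
  rw [← toReal_enorm]
  exact ENNReal.toReal_mono htop hw

theorem MemBMO.aestronglyMeasurable_toeplitz_integrand (hφ : MemBMO φ) (hf : Differentiable ℂ f)
    (z : ℂ) : AEStronglyMeasurable fun w => ((α / Real.pi * Real.exp (-α * ‖w‖ ^ 2) : ℝ) : ℂ) *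
        (φ w * f w * Complex.exp (α * z * conj w)) := by
  have hcont := hf.continuous
  refine AEStronglyMeasurable.mul (Continuous.aestronglyMeasurable (by fun_prop))
    ((hφ.aestronglyMeasurable.mul hcont.aestronglyMeasurable).mul
      (Continuous.aestronglyMeasurable ?_))
  have := Complex.continuous_conj
  fun_prop

theorem MemBMO.integrable_toeplitz_integrand (hα : 0 < α) (hφ : MemBMO φ)
    (hf : MemFockInfty α f) (z : ℂ) :
    Integrable fun w => ((α / Real.pi * Real.exp (-α * ‖w‖ ^ 2) : ℝ) : ℂ) *
        (φ w * f w * Complex.exp (α * z * conj w)) := by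
  have hpi := Real.pi_pos
  refine Integrable.mono' (((hφ.integrable_norm_mul_exp (half_pos hα) z).const_mul
    (fockNorm α f).toReal).const_mul (Real.exp (α * ‖z‖ ^ 2 / 2) * (α / Real.pi)))
    (hφ.aestronglyMeasurable_toeplitz_integrand hf.1 z) ?_
  filter_upwards [hf.ae_norm_weighted_le] with w hw
  rw [norm_toeplitz_integrand hα]
  gcongr

theorem MemBMO.integrable_toeplitz (hα : 0 < α) (hφ : MemBMO φ) (hf : MemFockInfty α f) (z : ℂ) :
    Integrable (fun w => φ w * f w * conj (kernel α z w)) (gaussian α) := by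
  simp_rw [integrable_gaussian_iff hα, conj_kernel]
  exact hφ.integrable_toeplitz_integrand hα hf z

theorem toeplitz_eq_integral (hα : 0 < α) (φ f : ℂ → ℂ) (z : ℂ) :
    toeplitz α φ f z = ∫ w, ((α / Real.pi * Real.exp (-α * ‖w‖ ^ 2) : ℝ) : ℂ) *
      (φ w * f w * Complex.exp (α * z * conj w)) := by
  simp_rw [toeplitz, integral_gaussian hα, conj_kernel]

theorem MemBMO.norm_weighted_toeplitz_le (hα : 0 < α) (hφ : MemBMO φ) (hf : MemFockInfty α f)
    (z : ℂ) :
    ‖weighted α (toeplitz α φ f) z‖ ≤ α / Real.pi * (fockNorm α f).toReal *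
      ∫ w, ‖φ w‖ * Real.exp (-(α / 2) * ‖z - w‖ ^ 2) := by
  have hpi := Real.pi_pos
  have hle : ‖toeplitz α φ f z‖ ≤ Real.exp (α * ‖z‖ ^ 2 / 2) * (α / Real.pi) *
      ((fockNorm α f).toReal * ∫ w, ‖φ w‖ * Real.exp (-(α / 2) * ‖z - w‖ ^ 2)) := by
    rw [toeplitz_eq_integral hα, ← integral_const_mul, ← integral_const_mul]
    refine norm_integral_le_of_norm_le (((hφ.integrable_norm_mul_exp (half_pos hα) z).const_mul
      (fockNorm α f).toReal).const_mul _) ?_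
    filter_upwards [hf.ae_norm_weighted_le] with w hw
    rw [norm_toeplitz_integrand hα]
    gcongr
  rw [norm_weighted]
  refine (mul_le_mul_of_nonneg_right hle (Real.exp_pos _).le).trans (le_of_eq ?_)
  have hexp : Real.exp (α * ‖z‖ ^ 2 / 2) * Real.exp (-α * ‖z‖ ^ 2 / 2) = 1 := by
    rw [← Real.exp_add, ← Real.exp_zero]; ring_nf
  linear_combination (α / Real.pi * (fockNorm α f).toReal *
      ∫ w, ‖φ w‖ * Real.exp (-(α / 2) * ‖z - w‖ ^ 2)) * hexp

/-- The integrand is holomorphic in `z`, so one differentiates under the integral sign. Moving `z`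
within the unit disc about `z₀` and the factor `α * conj w` each cost at most `e^{α‖w‖}`; lowering
the Gaussian exponent from `α/2` to `α/4` pays for both. -/
theorem MemBMO.differentiable_toeplitz (hα : 0 < α) (hφ : MemBMO φ) (hf : MemFockInfty α f) :
    Differentiable ℂ (toeplitz α φ f) := by
  have hpi := Real.pi_pos
  intro z₀
  set F : ℂ → ℂ → ℂ := fun z w => ((α / Real.pi * Real.exp (-α * ‖w‖ ^ 2) : ℝ) : ℂ) *
      (φ w * f w * Complex.exp (α * z * conj w))
  have hFeq : toeplitz α φ f = fun z => ∫ w, F z w := funext (toeplitz_eq_integral hα φ f)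
  have hbound : Integrable fun w =>
      (Real.exp (α * ‖z₀‖ ^ 2 / 2) * (α / Real.pi) * Real.exp (2 * α * ‖z₀‖ + 4 * α)) *
        ((fockNorm α f).toReal * (‖φ w‖ * Real.exp (-(α / 4) * ‖z₀ - w‖ ^ 2))) :=
    ((hφ.integrable_norm_mul_exp (b := α / 4) (by positivity) z₀).const_mul _).const_mul _
  have hderiv : ∀ w z, HasDerivAt (fun z => F z w) (F z w * (α * conj w)) z := by
    intro w z
    have h1 : HasDerivAt (fun z : ℂ => (α : ℂ) * z * conj w) (α * conj w) z := by
      simpa using ((hasDerivAt_id z).const_mul (α : ℂ)).mul_const (conj w)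
    have h2 := (h1.cexp.const_mul (φ w * f w)).const_mul
      ((α / Real.pi * Real.exp (-α * ‖w‖ ^ 2) : ℝ) : ℂ)
    refine h2.congr_deriv ?_
    simp only [F]
    ring
  have hle : ∀ᵐ w, ∀ z ∈ Metric.ball z₀ 1, ‖F z w * (α * conj w)‖ ≤
      (Real.exp (α * ‖z₀‖ ^ 2 / 2) * (α / Real.pi) * Real.exp (2 * α * ‖z₀‖ + 4 * α)) *
        ((fockNorm α f).toReal * (‖φ w‖ * Real.exp (-(α / 4) * ‖z₀ - w‖ ^ 2))) := by
    filter_upwards [hf.ae_norm_weighted_le] with w hw z hz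
    have hz' : ‖z - z₀‖ < 1 := by rwa [← dist_eq_norm]
    have hF : F z w = F z₀ w * Complex.exp (α * (z - z₀) * conj w) := by
      have : (α : ℂ) * z * conj w = α * z₀ * conj w + α * (z - z₀) * conj w := by ring
      simp only [F]
      rw [this, Complex.exp_add]
      ring
    have h1 : ‖Complex.exp (α * (z - z₀) * conj w)‖ ≤ Real.exp (α * ‖w‖) := by
      rw [Complex.norm_exp]
      refine Real.exp_le_exp.2 ((Complex.re_le_norm _).trans ?_)
      rw [norm_mul, norm_mul, Complex.norm_real, Real.norm_of_nonneg hα.le, RCLike.norm_conj]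
      gcongr
      exact mul_le_of_le_one_right hα.le hz'.le
    have h2 : ‖(α : ℂ) * conj w‖ ≤ Real.exp (α * ‖w‖) := by
      rw [norm_mul, Complex.norm_real, Real.norm_of_nonneg hα.le, RCLike.norm_conj]
      linarith [Real.add_one_le_exp (α * ‖w‖)]
    have h3 : Real.exp (α * ‖w‖) * Real.exp (α * ‖w‖) * Real.exp (-(α / 2) * ‖z₀ - w‖ ^ 2) ≤
        Real.exp (2 * α * ‖z₀‖ + 4 * α) * Real.exp (-(α / 4) * ‖z₀ - w‖ ^ 2) := by
      simp only [← Real.exp_add]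
      refine Real.exp_le_exp.2 ?_
      have htri : ‖w‖ ≤ ‖z₀‖ + ‖z₀ - w‖ := by
        have := norm_sub_le z₀ (z₀ - w)
        rwa [sub_sub_cancel] at this
      -- With `x = ‖z₀ - w‖` this uses `2x ≤ 4 + x²/4`, that is, `(x - 4)² ≥ 0`.
      have : 2 * ‖w‖ ≤ 2 * ‖z₀‖ + 4 + ‖z₀ - w‖ ^ 2 / 4 := by
        nlinarith [sq_nonneg (‖z₀ - w‖ - 4)]
      nlinarith
    rw [hF, norm_mul, norm_mul, norm_toeplitz_integrand hα]
    calc _ ≤ Real.exp (α * ‖z₀‖ ^ 2 / 2) * (α / Real.pi) * ((fockNorm α f).toReal *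
            (‖φ w‖ * Real.exp (-(α / 2) * ‖z₀ - w‖ ^ 2))) * Real.exp (α * ‖w‖) *
              Real.exp (α * ‖w‖) := by gcongr
      _ = Real.exp (α * ‖z₀‖ ^ 2 / 2) * (α / Real.pi) * ((fockNorm α f).toReal *
            (‖φ w‖ * (Real.exp (α * ‖w‖) * Real.exp (α * ‖w‖) *
              Real.exp (-(α / 2) * ‖z₀ - w‖ ^ 2)))) := by ring
      _ ≤ Real.exp (α * ‖z₀‖ ^ 2 / 2) * (α / Real.pi) * ((fockNorm α f).toReal *
            (‖φ w‖ * (Real.exp (2 * α * ‖z₀‖ + 4 * α) *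
              Real.exp (-(α / 4) * ‖z₀ - w‖ ^ 2)))) := by gcongr
      _ = _ := by ring
  have hmeas : ∀ z, AEStronglyMeasurable (F z) := fun z =>
    hφ.aestronglyMeasurable_toeplitz_integrand hf.1 z
  have := Complex.continuous_conj
  rw [hFeq]
  exact (hasDerivAt_integral_of_dominated_loc_of_deriv_le
    (F' := fun z w => F z w * (α * conj w)) (Metric.ball_mem_nhds z₀ one_pos)
    (Filter.Eventually.of_forall hmeas) (hφ.integrable_toeplitz_integrand hα hf z₀)
    ((hmeas z₀).mul (Continuous.aestronglyMeasurable (by fun_prop))) hle hbound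
    (Filter.Eventually.of_forall fun w z _ => hderiv w z)).2.differentiableAt

/-! ### Testing on reproducing kernels -/

theorem continuous_weighted (α : ℝ) (hf : Continuous f) : Continuous (weighted α f) := by
  unfold weighted
  fun_prop

/-- By continuity the almost everywhere bound holds on a closed dense set. The pointwise form is
needed because `T_φ K_z` is evaluated at the single point `z`. -/
theorem enorm_weighted_le_fockNorm (hf : Continuous f) (z : ℂ) :
    ‖weighted α f z‖ₑ ≤ fockNorm α f := by
  have hae : ∀ᵐ w, ‖weighted α f w‖ₑ ≤ fockNorm α f := by
    rw [fockNorm, eLpNorm_exponent_top]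
    exact ae_le_eLpNormEssSup
  have hclosed : IsClosed {w | ‖weighted α f w‖ₑ ≤ fockNorm α f} :=
    isClosed_le (continuous_weighted α hf).enorm continuous_const
  have : z ∈ closure {w | ‖weighted α f w‖ₑ ≤ fockNorm α f} := Measure.dense_of_ae hae z
  rwa [hclosed.closure_eq] at this

theorem differentiable_kernel (α : ℝ) (z : ℂ) : Differentiable ℂ (kernel α z) := by
  unfold kernel
  fun_prop

/-- The left side equals `e^{α‖z‖²/2} e^{-α‖z-w‖²/2}`. -/
theorem norm_weighted_kernel_le (hα : 0 < α) (z w : ℂ) :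
    ‖weighted α (kernel α z) w‖ ≤ Real.exp (α * ‖z‖ ^ 2 / 2) := by
  have h := norm_sub_sq_eq z w
  rw [norm_weighted, ← RCLike.norm_conj, conj_kernel, Complex.norm_exp, mul_assoc,
    Complex.re_ofReal_mul, ← Real.exp_add]
  refine Real.exp_le_exp.2 ?_
  nlinarith [sq_nonneg ‖z - w‖]

theorem memFockInfty_kernel (hα : 0 < α) (z : ℂ) : MemFockInfty α (kernel α z) :=
  ⟨differentiable_kernel α z, memLp_top_of_bound
    (continuous_weighted α (differentiable_kernel α z).continuous).aestronglyMeasurable _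
    (Filter.Eventually.of_forall (norm_weighted_kernel_le hα z))⟩

theorem fockNorm_kernel_le (hα : 0 < α) (z : ℂ) :
    fockNorm α (kernel α z) ≤ ENNReal.ofReal (Real.exp (α * ‖z‖ ^ 2 / 2)) := by
  rw [fockNorm, eLpNorm_exponent_top]
  exact eLpNormEssSup_le_of_ae_bound
    (Filter.Eventually.of_forall (norm_weighted_kernel_le hα z))

/-- On the diagonal the kernels combine to `|K_z(w)|² = e^{2α Re(z w̄)}`, which with `e^{-α|w|²}`
completes the square. -/
theorem weighted_toeplitz_kernel (hα : 0 < α) (φ : ℂ → ℂ) (z : ℂ) :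
    weighted α (toeplitz α φ (kernel α z)) z =
      ((Real.exp (α * ‖z‖ ^ 2 / 2) * (α / Real.pi) : ℝ) : ℂ) *
        ∫ w, φ w * (Real.exp (-α * ‖z - w‖ ^ 2) : ℂ) := by
  rw [weighted, toeplitz_eq_integral hα, ← integral_mul_const, ← integral_const_mul]
  congr 1 with w
  have hsum : (α : ℂ) * conj z * w + α * z * conj w = ((2 * α * (z * conj w).re : ℝ) : ℂ) := by
    apply Complex.ext <;> simp <;> ring
  have hker : kernel α z w * Complex.exp (α * z * conj w) =
      ((Real.exp (2 * α * (z * conj w).re) : ℝ) : ℂ) := by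
    rw [kernel, ← Complex.exp_add, hsum, Complex.ofReal_exp]
  have hexp : Real.exp (-α * ‖w‖ ^ 2) * Real.exp (2 * α * (z * conj w).re) *
      Real.exp (-α * ‖z‖ ^ 2 / 2) = Real.exp (α * ‖z‖ ^ 2 / 2) * Real.exp (-α * ‖z - w‖ ^ 2) := by
    rw [norm_sub_sq_eq]
    simp only [← Real.exp_add]
    ring_nf
  have hexpC := congrArg (fun x : ℝ => (x : ℂ)) hexp
  simp only [Complex.ofReal_mul, Complex.ofReal_div] at hexpC ⊢
  linear_combination (α / Real.pi * φ w * Real.exp (-α * ‖w‖ ^ 2) *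
    Real.exp (-α * ‖z‖ ^ 2 / 2) : ℂ) * hker + (α / Real.pi * φ w : ℂ) * hexpC

/-- The growth factor `e^{α‖z‖²/2}` in the test value cancels against the bound for the norm of
`K_z`, leaving an estimate uniform in `z`. -/
theorem norm_integral_mul_exp_le_of_toeplitz_le (hα : 0 < α) {C : NNReal}
    (hC : ∀ f : ℂ → ℂ, MemFockInfty α f →
      MemFockInfty α (toeplitz α φ f) ∧ fockNorm α (toeplitz α φ f) ≤ C * fockNorm α f) (z : ℂ) :
    ‖∫ w, φ w * (Real.exp (-α * ‖z - w‖ ^ 2) : ℂ)‖ ≤ C * (Real.pi / α) := by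
  have hpi := Real.pi_pos
  obtain ⟨hmem, hle⟩ := hC _ (memFockInfty_kernel hα z)
  have h := (enorm_weighted_le_fockNorm hmem.1.continuous z).trans
    (hle.trans (mul_le_mul_right (fockNorm_kernel_le hα z) _))
  rw [← ENNReal.ofReal_coe_nnreal, ← ENNReal.ofReal_mul C.coe_nonneg, ← ofReal_norm,
    ENNReal.ofReal_le_ofReal_iff (by positivity), weighted_toeplitz_kernel hα, norm_mul,
    Complex.norm_real, Real.norm_of_nonneg (by positivity), mul_assoc, mul_comm (C : ℝ)] at h
  have h' := le_of_mul_le_mul_left h (Real.exp_pos _)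
  have h2 : α / Real.pi * (C * (Real.pi / α)) = C := by field_simp
  exact le_of_mul_le_mul_left (h'.trans h2.ge) (by positivity)

/-! ### The Berezin transform and the equivalence -/

theorem berezin_eq (α t : ℝ) (φ : ℂ → ℂ) (z : ℂ) :
    berezin α t φ z = (α / Real.pi : ℂ) *
      ∫ w, φ w * (Real.exp (-(α * t / 2) * ‖z - w‖ ^ 2) : ℂ) := by
  rw [berezin]
  congr 3 with w
  ring_nf

theorem norm_berezin (hα : 0 < α) (t : ℝ) (φ : ℂ → ℂ) (z : ℂ) :
    ‖berezin α t φ z‖ = α / Real.pi *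
      ‖∫ w, φ w * (Real.exp (-(α * t / 2) * ‖z - w‖ ^ 2) : ℂ)‖ := by
  have hpi := Real.pi_pos
  rw [berezin_eq, norm_mul, ← Complex.ofReal_div, Complex.norm_real,
    Real.norm_of_nonneg (by positivity)]

theorem aestronglyMeasurable_berezin (hφ : AEStronglyMeasurable φ) (α t : ℝ) :
    AEStronglyMeasurable (berezin α t φ) := by
  refine aestronglyMeasurable_const.mul (AEStronglyMeasurable.integral_prod_right'
    (f := fun p : ℂ × ℂ => φ p.2 * (Real.exp (-α * t * ‖p.1 - p.2‖ ^ 2 / 2) : ℂ)) ?_)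
  exact hφ.comp_snd.mul (Continuous.aestronglyMeasurable (by fun_prop))

theorem MemBMO.memLp_berezin (hα : 0 < α) {t : ℝ} (ht : 0 < t) (hφ : MemBMO φ)
    (h : ToeplitzBounded α φ) : MemLp (berezin α t φ) ⊤ volume := by
  have hpi := Real.pi_pos
  obtain ⟨C, hC⟩ := h
  have hat : 0 < α * t / 2 := by positivity
  obtain ⟨A, B, hB, hAB⟩ := hφ.exists_integral_norm_mul_exp_le hat hα
  refine memLp_top_of_bound (aestronglyMeasurable_berezin hφ.aestronglyMeasurable α t)
    (α / Real.pi * (A + B * (C * (Real.pi / α)))) (Filter.Eventually.of_forall fun z => ?_)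
  rw [norm_berezin hα]
  gcongr
  calc _ ≤ ∫ w, ‖φ w‖ * Real.exp (-(α * t / 2) * ‖z - w‖ ^ 2) := by
        refine (norm_integral_le_integral_norm _).trans (le_of_eq ?_)
        simp only [norm_mul, Complex.norm_real, Real.norm_of_nonneg (Real.exp_pos _).le]
    _ ≤ A + B * ‖∫ w, φ w * (Real.exp (-α * ‖z - w‖ ^ 2) : ℂ)‖ := hAB z
    _ ≤ _ := by
        gcongr
        exact norm_integral_mul_exp_le_of_toeplitz_le hα hC z

theorem MemBMO.toeplitzBounded (hα : 0 < α) {t : ℝ} (ht : 0 < t) (hφ : MemBMO φ)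
    (h : MemLp (berezin α t φ) ⊤ volume) : ToeplitzBounded α φ := by
  have hpi := Real.pi_pos
  have hat : 0 < α * t / 2 := by positivity
  obtain ⟨A, B, hB, hAB⟩ := hφ.exists_integral_norm_mul_exp_le (half_pos hα) hat
  set N := (eLpNorm (berezin α t φ) ⊤ volume).toReal
  have hN : ∀ᵐ z, ‖berezin α t φ z‖ ≤ N := by
    filter_upwards [ae_le_eLpNormEssSup (f := berezin α t φ) (μ := volume)] with w hw
    rw [← eLpNorm_exponent_top] at hw
    rw [← toReal_enorm]
    exact ENNReal.toReal_mono h.2.ne hw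
  set C := α / Real.pi * (A + B * (Real.pi / α * N))
  have hbound : ∀ f, MemFockInfty α f →
      ∀ᵐ z, ‖weighted α (toeplitz α φ f) z‖ ≤ C * (fockNorm α f).toReal := by
    intro f hf
    filter_upwards [hN] with z hz
    rw [norm_berezin hα] at hz
    have hz' : ‖∫ w, φ w * (Real.exp (-(α * t / 2) * ‖z - w‖ ^ 2) : ℂ)‖ ≤ Real.pi / α * N := by
      calc _ = Real.pi / α * (α / Real.pi *
            ‖∫ w, φ w * (Real.exp (-(α * t / 2) * ‖z - w‖ ^ 2) : ℂ)‖) := by field_simp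
        _ ≤ _ := by gcongr
    calc _ ≤ _ := hφ.norm_weighted_toeplitz_le hα hf z
      _ ≤ α / Real.pi * (fockNorm α f).toReal * (A + B * (Real.pi / α * N)) := by
          gcongr
          exact (hAB z).trans (by gcongr)
      _ = _ := by simp only [C]; ring
  -- The sign of `A`, hence of `C`, is not recorded; truncation at `0` is harmless because `C`
  -- multiplies a nonnegative norm.
  refine ⟨C.toNNReal, fun f hf => ?_⟩
  have hdiff := hφ.differentiable_toeplitz hα hf
  refine ⟨⟨hdiff, memLp_top_of_bound
    (continuous_weighted α hdiff.continuous).aestronglyMeasurable _ (hbound f hf)⟩, ?_⟩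
  rw [fockNorm, eLpNorm_exponent_top]
  refine (eLpNormEssSup_le_of_ae_bound (hbound f hf)).trans ?_
  rw [ENNReal.ofReal_mul' ENNReal.toReal_nonneg, ENNReal.ofReal_toReal (show fockNorm α f ≠ ⊤ from hf.2.2.ne)]
  rfl

end FockToeplitz

theorem theorem4p5 (α : ℝ) (hα : 0 < α) (φ : ℂ → ℂ) (hφ : FockToeplitz.MemBMO φ) :
    -- the integrals defining `T_φ` on `F^∞_α` and the `t`-Berezin transforms converge absolutely
    (∀ f : ℂ → ℂ, FockToeplitz.MemFockInfty α f → ∀ z : ℂ,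
      Integrable (fun w => φ w * f w * conj (FockToeplitz.kernel α z w))
        (FockToeplitz.gaussian α)) ∧
    (∀ t : ℝ, 0 < t → ∀ z : ℂ,
      Integrable (fun w : ℂ => φ w * (Real.exp (-α * t * ‖z - w‖ ^ 2 / 2) : ℂ)) volume) ∧
    -- for each `t > 0`, boundedness of `T_φ` is equivalent to boundedness of `φ̃_t`
    (∀ t : ℝ, 0 < t →
      (FockToeplitz.ToeplitzBounded α φ ↔ MemLp (FockToeplitz.berezin α t φ) ⊤ volume)) := by
  refine ⟨fun f hf z => hφ.integrable_toeplitz hα hf z, fun t ht z => ?_,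
    fun t ht => ⟨hφ.memLp_berezin hα ht, hφ.toeplitzBounded hα ht⟩⟩
  have hat : 0 < α * t / 2 := by positivity
  refine (hφ.integrable_mul_exp hat z).congr (Filter.Eventually.of_forall fun w => ?_)
  ring_nf
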